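/- \textbf{Block constructions.} Let $\mathcal A$ be a finite alphabet. Start with a finite set $\mathcal C_1$ of words over $\mathcal A$ of a common length $l_1$. Suppose that a set $\mathcal C_j$ of $N_j$ words of common length $l_j$ has been constructed; fix an arbitrary ordering $\mathcal C_j=\{u^{(j)}_1,\dots,u^{(j)}_{N_j}\}$ and let $P_j\subset\{1,\dots,N_j\}$ be a set of ``permuted'' positions. Then $\mathcal C_{j+1}$ is the set of all words $$u^{(j)}_{\pi(1)}u^{(j)}_{\pi(2)}\cdots u^{(j)}_{\pi(N_j)},$$ where $\pi$ runs over the permutations of $\{1,\dots,N_j\}$ that fix every $i\notin P_j$. In the version with a spacer symbol $b$, the letter $b$ is in addition inserted immediately in front of each position $i\in P_j$. Let $l_{j+1}$ be the common length of the words of $\mathcal C_{j+1}$ (so $l_{j+1}=l_jN_j$, respectively $l_{j+1}=l_jN_j+|P_j|$ with spacers) and $N_{j+1}=|\mathcal C_{j+1}|$. The subshift $X$ of the construction is the set of all $x\in\mathcal A^{\mathbb Z}$ each finite subword of which is a subword of a word of $\mathcal C_j$ for some $j$; let $\sigma$ be the left shift. \textbf{Theorem.} Let $X$ be the subshift of one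 of the following block constructions: \begin{enumerate} \item $\mathcal A=\{0,1\}$, no spacers, and $P_j=\bigl(\{2\}\cup\{i^2:2\le i\le\lfloor\sqrt{N_j}\rfloor\}\bigr)\cap\{1,\dots,N_j\}$; \item $\mathcal A=\{0,1\}$, no spacers, and $P_j=\{i^{\lfloor1/\alpha\rfloor}:1<i\le N_j^{\alpha}\}$, for some fixed $\alpha\in(0,1)$; \item $\mathcal A=\{0,1,b\}$, with spacer symbol $b$, $\mathcal C_1$ consisting of words over $\{0,1\}$, and $P_j=\{i^2:1<i\le\lfloor\sqrt{N_j}\rfloor\}$. \end{enumerate} Then $X$ is metrically rigid along $(l_n)_{n\in\mathbb N}$: for every $\sigma$-invariant Borel probability measure $\mu$ on $X$ (in particular for the unique one, when $X$ is uniquely ergodic) and every Borel set $A$, $$\lim_{n\to\infty}\mu\bigl(\sigma^{l_n}A\,\triangle\,A\bigr)=0 .$$ -/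

import Mathlib

open MeasureTheory Filter
open scoped Topology symmDiff

/-- The left shift `σ` on bi-infinite sequences over an alphabet `A`. -/
def leftShift {A : Type} (x : ℤ → A) : ℤ → A := fun n => x (n + 1)

open Classical in
/-- Given an ordered list of words `u 0, …, u (N - 1)` (the word `u i` has position `i + 1`), a set
`P` of positions, a spacer word `s` and a permutation `π`, this is the concatenation of the words
`u (π 0), u (π 1), …, u (π (N - 1))` with a copy of `s` put in front of each position in `P`.
(`s = []` means that there are no spacers.) -/
noncomputable def permutedConcat {A : Type} {N : ℕ} (P : Set ℕ) (s : List A)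
    (u : Fin N → List A) (π : Equiv.Perm (Fin N)) : List A :=
  (List.ofFn fun i : Fin N => (if (i : ℕ) + 1 ∈ P then s else []) ++ u (π i)).flatten

/-- A run of the inductive block construction over the alphabet `A`, where `P N` is the set of
permuted positions used when there are `N` words, and `s` is the spacer word in front of permuted
positions. Levels are numbered from `0`. At level `j` there is a set `C_j` of `N j` distinct words
of length `l j`, with an ordering `u j` of it. The level-`0` set and all the orderings are
arbitrary. -/
structure BlockConstruction (A : Type) (P : ℕ → Set ℕ) (s : List A) where
  /-- the number of words at each level -/
  N : ℕ → ℕ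
  /-- the length of the words at each level -/
  l : ℕ → ℕ
  /-- the ordered words at each level -/
  u : (j : ℕ) → Fin (N j) → List A
  /-- the words at one level are distinct -/
  u_injective : ∀ j, Function.Injective (u j)
  /-- the initial words have length `l 0` -/
  length_zero : ∀ i, (u 0 i).length = l 0
  /-- the length of a concatenation of all the words of level `j`, with its spacers -/
  l_succ : ∀ j, l (j + 1) = l j * N j + s.length * Nat.card {i : Fin (N j) // (i : ℕ) + 1 ∈ P (N j)}
  /-- the words of level `j + 1` are exactly those obtained from the concatenation of all words of
  level `j` in order, by permuting among themselves the words at positions in `P (N j)` -/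
  range_succ : ∀ j, Set.range (u (j + 1)) =
    {w | ∃ π : Equiv.Perm (Fin (N j)),
      (∀ i : Fin (N j), (i : ℕ) + 1 ∉ P (N j) → π i = i) ∧ w = permutedConcat (P (N j)) s (u j) π}

/-- Every word of level `j` has length `l j`. -/
theorem BlockConstruction.length_u {A : Type} {P : ℕ → Set ℕ} {s : List A}
    (S : BlockConstruction A P s) (j : ℕ) (i : Fin (S.N j)) : (S.u j i).length = S.l j := by
  classical
  induction j with
  | zero => exact S.length_zero i
  | succ j ih =>
    have hi : S.u (j + 1) i ∈ Set.range (S.u (j + 1)) := ⟨i, rfl⟩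
    rw [S.range_succ] at hi
    obtain ⟨π, -, hw⟩ := hi
    have key : ∀ k : Fin (S.N j), ((if (k : ℕ) + 1 ∈ P (S.N j) then s else []) ++
        S.u j (π k)).length = (if (k : ℕ) + 1 ∈ P (S.N j) then s.length else 0) + S.l j := by
      intro k
      split_ifs <;> simp [ih]
    rw [hw, S.l_succ, permutedConcat, List.length_flatten, List.map_ofFn, List.sum_ofFn]
    simp only [Function.comp_def, key, Finset.sum_add_distrib]
    rw [Nat.card_eq_fintype_card, Fintype.card_subtype, ← Finset.sum_filter, Finset.sum_const,
      Finset.sum_const]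
    simp [mul_comm, add_comm]

/-- The subshift of a block construction: all bi-infinite sequences each finite word of which is a
subword of some word of some level. -/
def BlockConstruction.subshift {A : Type} {P : ℕ → Set ℕ} {s : List A}
    (S : BlockConstruction A P s) : Set (ℤ → A) :=
  {x | ∀ (m : ℤ) (n : ℕ), ∃ (j : ℕ) (i : Fin (S.N j)),
    (List.ofFn fun t : Fin n => x (m + ((t : ℕ) : ℤ))) <:+: S.u j i}

/-- The permuted positions `{2} ∪ {i² : 2 ≤ i ≤ √N}`. -/
def squarePositions (N : ℕ) : Set ℕ := {2} ∪ {p | ∃ i : ℕ, 2 ≤ i ∧ i ≤ Nat.sqrt N ∧ p = i ^ 2}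

/-- The permuted positions `i ^ ⌊1/α⌋` for `1 < i ≤ N ^ α`. -/
def powerPositions (α : ℝ) (N : ℕ) : Set ℕ :=
  {p | ∃ i : ℕ, 1 < i ∧ (i : ℝ) ≤ (N : ℝ) ^ α ∧ p = i ^ ⌊1 / α⌋₊}

/-- The permuted positions `i²` for `1 < i ≤ √N` of the construction with spacers. -/
def spacerPositions (N : ℕ) : Set ℕ := {p | ∃ i : ℕ, 1 < i ∧ i ≤ Nat.sqrt N ∧ p = i ^ 2}

/-- `μ` is a shift-invariant Borel probability measure carried by `X`. -/
structure IsInvariantProbabilityOn {A : Type} [MeasurableSpace A]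
    (X : Set (ℤ → A)) (μ : Measure (ℤ → A)) : Prop where
  isProbabilityMeasure : IsProbabilityMeasure μ
  measurePreserving : MeasurePreserving leftShift μ μ
  compl_eq_zero : μ Xᶜ = 0

/-- Metric rigidity along the sequence `l`: `μ (σ^{l n} E ∆ E) → 0` for all measurable `E`. -/
def IsMetricallyRigidAlong {A : Type} [MeasurableSpace A]
    (μ : Measure (ℤ → A)) (l : ℕ → ℕ) : Prop :=
  ∀ E : Set (ℤ → A), MeasurableSet E →
    Tendsto (fun n => μ ((leftShift^[l n] '' E) ∆ E)) atTop (𝓝 0)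

/-! Words of one level nearly agree. Two words of level `n + 1` carry the same level-`n` words
outside the `p_n` permuted positions, so they differ in at most `D_n p_n` letters, where `D_n`
bounds the differences at level `n`. Since `l_(n+1) ≥ l_n N_n` and `p_n ≤ c N_n` with `c < 1`, it
follows that `D_n / l_n ≤ c ^ n → 0`.

Up to its two ends, a window of a point of `X` is a concatenation of level-`n` words and spacers.
Shifting by `l_n` compares each word with its successor, at a cost of at most `D_n`, unless a spacer
intervenes and spoils the alignment of about one word. As `1 ∉ P`, no word starts with a spacer, so
spacers never pile up, and `N_n` consecutive words forming a level-`(n + 1)` word see at most `p_n +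
1` of them. The mismatch density is thus at most of order `D_n / l_n + (p_n + 1) / N_n`, the second
term occurring only with spacers.

Averaging against an invariant `μ` gives `μ {x | x 0 ≠ x (l n)} → 0`, which passes to cylinders and
then to all Borel sets. With spacers one also needs `N_n → ∞`, which follows from `N_(n+1) = p_n!`.
-/

/-! ### Cutting a window out of a concatenation -/

theorem exists_of_prefix_flatten {α : Type*} (Q : List α → Prop) (hnil : Q []) (L : List (List α))
    (hQ : ∀ x ∈ L, ∀ y, y <:+: x → Q y) (v : List α) (hv : v <+: L.flatten) :
    ∃ L' b, v = L'.flatten ++ b ∧ L' <+: L ∧ Q b := by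
  induction L generalizing v with
  | nil => exact ⟨[], [], by simpa using hv, by simp, hnil⟩
  | cons x L ih =>
    obtain ⟨r, hr⟩ := hv
    rw [List.flatten_cons, List.append_eq_append_iff] at hr
    rcases hr with ⟨c, hc, -⟩ | ⟨c, hc, hc'⟩
    · exact ⟨[], v, by simp, by simp, hQ x (by simp) v ⟨[], c, by simp [hc]⟩⟩
    · obtain ⟨L', b, h1, h2, h3⟩ := ih (fun y hy => hQ y (by simp [hy])) c ⟨r, hc'.symm⟩
      exact ⟨x :: L', b, by simp [hc, h1], by simpa using h2, h3⟩

/-- An infix of a concatenation consists of an infix of one factor, a concatenation of consecutive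
factors, and an infix of one factor. -/
theorem exists_of_infix_flatten {α : Type*} (Q : List α → Prop) (hnil : Q []) (L : List (List α))
    (hQ : ∀ x ∈ L, ∀ y, y <:+: x → Q y) (v : List α) (hv : v <:+: L.flatten) :
    ∃ L' a b, v = a ++ L'.flatten ++ b ∧ L' <:+: L ∧ Q a ∧ Q b := by
  induction L with
  | nil => exact ⟨[], [], [], by simpa using hv, by simp, hnil, hnil⟩
  | cons x L ih =>
    have hQ' : ∀ y ∈ L, ∀ z, z <:+: y → Q z := fun y hy => hQ y (by simp [hy])
    rw [List.flatten_cons, List.infix_append_iff] at hv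
    rcases hv with hv | hv | ⟨a, w, rfl, ha, hw⟩
    · exact ⟨[], v, [], by simp, by simp, hQ x (by simp) v hv, hnil⟩
    · obtain ⟨L', a, b, h1, h2, h3⟩ := ih hQ' hv
      exact ⟨L', a, b, h1, List.infix_cons h2, h3⟩
    · obtain ⟨L', b, h1, h2, h3⟩ := exists_of_prefix_flatten Q hnil L hQ' w hw
      exact ⟨L', a, b, by simp [h1], List.infix_cons h2.isInfix,
        hQ x (by simp) a ha.isInfix, h3⟩

/-! ### Hamming mismatches between a word and its shift -/

section Mismatch

variable {A : Type} [DecidableEq A]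

/-- The number of positions at which two words differ, up to the end of the shorter one. -/
def mismatch (a b : List A) : ℕ := (a.zip b).countP fun q => q.1 ≠ q.2

/-- The number of positions at which a word differs from its shift by `l`. -/
def shiftMismatch (l : ℕ) (w : List A) : ℕ := mismatch w (w.drop l)

theorem mismatch_le_left (a b : List A) : mismatch a b ≤ a.length :=
  List.countP_le_length.trans (by simp)

theorem mismatch_le_right (a b : List A) : mismatch a b ≤ b.length :=
  List.countP_le_length.trans (by simp)

@[simp] theorem mismatch_self (a : List A) : mismatch a a = 0 := by
  induction a with
  | nil => rfl
  | cons x a ih => simpa [mismatch] using ih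

theorem mismatch_append {a b : List A} (h : a.length = b.length) (c d : List A) :
    mismatch (a ++ c) (b ++ d) = mismatch a b + mismatch c d := by
  rw [mismatch, List.zip_append h, List.countP_append]; rfl

theorem mismatch_cons (x y : A) (a b : List A) :
    mismatch (x :: a) (y :: b) = (if x ≠ y then 1 else 0) + mismatch a b := by
  simp [mismatch, List.countP_cons, add_comm]

theorem mismatch_append_le (a b c d : List A) (h : b.length ≤ a.length) :
    mismatch (a ++ c) (b ++ d) ≤ mismatch a b + d.length := by
  induction b generalizing a with
  | nil => simpa using (mismatch_le_right (a ++ c) d).trans (Nat.le_add_left _ _)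
  | cons y b ih =>
    cases a with
    | nil => simp at h
    | cons x a =>
      have := ih a (by simpa using h)
      simp only [List.cons_append, mismatch_cons]
      omega

theorem mismatch_flatten_ofFn {N : ℕ} (f g : Fin N → List A)
    (h : ∀ i, (f i).length = (g i).length) :
    mismatch (List.ofFn f).flatten (List.ofFn g).flatten = ∑ i, mismatch (f i) (g i) := by
  induction N with
  | zero => simp
  | succ N ih =>
    rw [List.ofFn_succ, List.ofFn_succ, List.flatten_cons, List.flatten_cons,
      mismatch_append (h 0), ih _ _ fun i => h i.succ, Fin.sum_univ_succ]

theorem shiftMismatch_cons_le (l : ℕ) (x : A) (w : List A) :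
    shiftMismatch l (x :: w) ≤ 1 + shiftMismatch l w := by
  unfold shiftMismatch
  cases l with
  | zero => simp
  | succ l =>
    rw [List.drop_succ_cons, ← List.drop_drop (i := 1) (j := l)]
    cases w.drop l with
    | nil => simp [mismatch]
    | cons y b =>
      rw [mismatch_cons]
      simp only [List.drop_succ_cons, List.drop_zero]
      split_ifs <;> omega

theorem shiftMismatch_append_le_left (l : ℕ) (a w : List A) :
    shiftMismatch l (a ++ w) ≤ a.length + shiftMismatch l w := by
  induction a with
  | nil => simp
  | cons x a ih =>
    have := shiftMismatch_cons_le l x (a ++ w)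
    simp only [List.cons_append, List.length_cons]
    omega

theorem shiftMismatch_append_le_right (l : ℕ) (w c : List A) :
    shiftMismatch l (w ++ c) ≤ shiftMismatch l w + c.length := by
  unfold shiftMismatch
  rw [List.drop_append]
  exact (mismatch_append_le _ _ _ _ (by simp)).trans (by simp)

theorem shiftMismatch_append_append {l : ℕ} (a b w : List A) (ha : a.length = l)
    (hb : b.length = l) :
    shiftMismatch l (a ++ (b ++ w)) = mismatch a b + shiftMismatch l (b ++ w) := by
  unfold shiftMismatch
  rw [List.drop_left' ha, mismatch_append (ha.trans hb.symm), List.drop_left' hb]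

theorem shiftMismatch_eq_zero {l : ℕ} (a : List A) (ha : a.length ≤ l) :
    shiftMismatch l a = 0 := by
  simp [shiftMismatch, List.drop_eq_nil_of_le ha, mismatch]

end Mismatch

/-- The word spelled by a sequence of indices of words `u i`, with the spacer word `s` in front of
those that are flagged. -/
def spell {A ι : Type} (s : List A) (u : ι → List A) (L : List (Bool × ι)) : List A :=
  (L.map fun q => (if q.1 then s else []) ++ u q.2).flatten

/-! ### Words spelled by shorter words and spacers -/

section Spell

variable {A ι : Type} {s : List A} {u : ι → List A}

theorem spell_cons (b : Bool) (i : ι) (L : List (Bool × ι)) :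
    spell s u ((b, i) :: L) = (if b then s else []) ++ (u i ++ spell s u L) := by
  simp [spell]

theorem spell_append (L L' : List (Bool × ι)) :
    spell s u (L ++ L') = spell s u L ++ spell s u L' := by
  simp [spell]

theorem length_mul_le_length_spell {l : ℕ} (hu : ∀ i, (u i).length = l) (L : List (Bool × ι)) :
    L.length * l ≤ (spell s u L).length := by
  induction L with
  | nil => simp
  | cons q L ih =>
    obtain ⟨b, i⟩ := q
    rw [spell_cons]
    simp only [List.length_append, List.length_cons, hu]
    linarith

/-- Each unflagged word is aligned with its predecessor and costs `D`. At a flagged one, the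
preceding word and the spacer are written off entirely, which costs `K`. Without spacers flags are
harmless, so `K = 0` is allowed. -/
theorem shiftMismatch_spell_le [DecidableEq A] {l D K : ℕ} (hu : ∀ i, (u i).length = l)
    (hD : ∀ i j, mismatch (u i) (u j) ≤ D) (hK : s = [] ∨ l + s.length ≤ K)
    (L : List (Bool × ι)) :
    shiftMismatch l (spell s u L) ≤ D * L.length + K * (L.countP fun q => q.1) := by
  -- The induction carries the preceding word `u i`, the one compared with the head of `L`.
  have key : ∀ (i : ι) (L : List (Bool × ι)),
      shiftMismatch l (u i ++ spell s u L) ≤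
        D * L.length + K * (L.countP fun q => q.1) := by
    intro i L
    induction L generalizing i with
    | nil => simp [spell, shiftMismatch_eq_zero _ (hu i).le]
    | cons q L ih =>
      obtain ⟨b, j⟩ := q
      have hj := ih j
      have hm := shiftMismatch_append_append (u i) (u j) (spell s u L) (hu i) (hu j)
      have hd := hD i j
      rw [spell_cons]
      simp only [List.length_cons, List.countP_cons, mul_add]
      by_cases hb : b = true ∧ s ≠ []
      · have hl := hK.resolve_left hb.2
        have h1 := shiftMismatch_append_le_left l (u i) (s ++ (u j ++ spell s u L))
        have h2 := shiftMismatch_append_le_left l s (u j ++ spell s u L)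
        simp only [hb.1, if_true]
        rw [hu] at h1
        omega
      · have : (if b = true then s else []) = [] := by
          by_cases hb' : b = true
          · simpa [hb'] using hb
          · simp [hb']
        rw [this, List.nil_append, hm]
        omega
  cases L with
  | nil => simp [spell, shiftMismatch, mismatch]
  | cons q L =>
    obtain ⟨b, i⟩ := q
    have hi := key i L
    have h2 := shiftMismatch_append_le_left l (if b then s else []) (u i ++ spell s u L)
    have h3 : (if b then s else []).length ≤ K * (if b = true then 1 else 0) := by
      rcases hK with rfl | hK
      · simp
      · split_ifs <;> simp; omega
    rw [spell_cons]
    simp only [List.length_cons, List.countP_cons, mul_add]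
    omega

/-- A window of a spelled word is itself a spelled word, up to two short ends. -/
theorem exists_infix_of_infix_spell {l k : ℕ} (hu : ∀ i, (u i).length = l)
    (hs : s.length ≤ k) (L : List (Bool × ι)) (v : List A) (hv : v <:+: spell s u L) :
    ∃ L' a b, v = a ++ spell s u L' ++ b ∧ L' <:+: L ∧ a.length ≤ l + k ∧ b.length ≤ l + k := by
  obtain ⟨M, a, b, h1, h2, h3⟩ := exists_of_infix_flatten (fun y => y.length ≤ l + k) (by simp) _
    (by
      intro x hx y hy
      obtain ⟨q, -, rfl⟩ := List.mem_map.1 hx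
      refine hy.length_le.trans ?_
      rw [List.length_append, hu]
      split_ifs
      · omega
      · simp) v hv
  rw [List.infix_map_iff] at h2
  obtain ⟨L', hL, rfl⟩ := h2
  exact ⟨L', a, b, h1, hL, h3⟩

end Spell

/-- The number of flags in consecutive terms of a sequence that consists of groups of length `n`
with at most `c` flags each. -/
theorem countP_mul_le_of_infix_flatten {β : Type*} (f : β → Bool) {n c : ℕ} (G : List (List β))
    (hG : ∀ g ∈ G, g.length = n ∧ g.countP f ≤ c) (L : List β) (hL : L <:+: G.flatten) :
    L.countP f * n ≤ c * (L.length + 2 * n) := by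
  obtain ⟨G', a, b, rfl, h2, h3, h4⟩ := exists_of_infix_flatten (fun y => y.countP f ≤ c)
    (by simp) G (fun x hx y hy => (hy.sublist.countP_le).trans (hG x hx).2) L hL
  have hG' : G'.flatten.countP f ≤ c * G'.length ∧ G'.flatten.length = n * G'.length := by
    have hG2 : ∀ g ∈ G', g.length = n ∧ g.countP f ≤ c := fun g hg => hG g (h2.subset hg)
    clear h2 hL
    induction G' with
    | nil => simp
    | cons g G' ih =>
      have h5 := hG2 g (by simp)
      have h6 := ih fun g hg => hG2 g (by simp [hg])
      simp only [List.flatten_cons, List.countP_append, List.length_append, List.length_cons,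
        mul_add, mul_one]
      omega
  simp only [List.countP_append, List.length_append]
  -- The two cut groups at the ends may still hold `c` flags each, hence the `2 * n`.
  calc _ ≤ (c + c * G'.length + c) * n := by gcongr; exact hG'.1
    _ = c * (n * G'.length + 2 * n) := by ring
    _ ≤ _ := by rw [← hG'.2]; gcongr; omega

theorem countP_ofFn_eq_card {α : Type*} (p : α → Bool) {N : ℕ} (f : Fin N → α) :
    (List.ofFn f).countP p = Nat.card {i : Fin N // p (f i) = true} := by
  classical
  rw [Nat.card_eq_fintype_card, Fintype.card_subtype, Finset.card_filter]
  induction N with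
  | zero => simp
  | succ N ih => rw [List.ofFn_succ, List.countP_cons, ih, Fin.sum_univ_succ, add_comm]

theorem exists_permutedConcat_eq_spell {A : Type} {N : ℕ} (P : Set ℕ) (s : List A)
    (u : Fin N → List A) (π : Equiv.Perm (Fin N)) (hN : 0 < N) (hP : 1 ∉ P) :
    ∃ i L, permutedConcat P s u π = spell s u ((false, i) :: L) ∧ L.length + 1 = N ∧
      (L.countP fun q => q.1) ≤ Nat.card {i : Fin N // (i : ℕ) + 1 ∈ P} := by
  classical
  obtain ⟨M, rfl⟩ : ∃ M, N = M + 1 := ⟨N - 1, by omega⟩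
  let f : Fin (M + 1) → Bool × Fin (M + 1) := fun k => (decide ((k : ℕ) + 1 ∈ P), π k)
  have hf : List.ofFn f = (false, π 0) :: List.ofFn fun k : Fin M => f k.succ := by
    rw [List.ofFn_succ]; simp [f, hP]
  refine ⟨π 0, List.ofFn fun k : Fin M => f k.succ, ?_, by simp, ?_⟩
  · rw [← hf, permutedConcat, spell, List.map_ofFn]
    simp [f, Function.comp_def]
  · have h1 := countP_ofFn_eq_card (fun q : Bool × Fin (M + 1) => q.1) f
    rw [hf, List.countP_cons] at h1
    simp only [f, decide_eq_true_eq] at h1 ⊢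
    omega

/-! ### Mismatch bounds between and inside words of a construction -/

namespace BlockConstruction

variable {A : Type} {P : ℕ → Set ℕ} {s : List A} (S : BlockConstruction A P s)

/-- The number of permuted positions at level `n`. -/
noncomputable def numPermuted (n : ℕ) : ℕ :=
  Nat.card {i : Fin (S.N n) // (i : ℕ) + 1 ∈ P (S.N n)}

/-- A bound for the number of positions at which two words of level `n` differ. -/
noncomputable def diffBound : ℕ → ℕ
  | 0 => S.l 0
  | n + 1 => S.numPermuted n * diffBound n

theorem exists_eq_permutedConcat (n : ℕ) (i : Fin (S.N (n + 1))) :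
    ∃ π : Equiv.Perm (Fin (S.N n)), (∀ i : Fin (S.N n), (i : ℕ) + 1 ∉ P (S.N n) → π i = i) ∧
      S.u (n + 1) i = permutedConcat (P (S.N n)) s (S.u n) π := by
  have h : S.u (n + 1) i ∈ Set.range (S.u (n + 1)) := ⟨i, rfl⟩
  rwa [S.range_succ] at h

theorem mismatch_le_diffBound [DecidableEq A] (n : ℕ) (i j : Fin (S.N n)) :
    mismatch (S.u n i) (S.u n j) ≤ S.diffBound n := by
  classical
  induction n with
  | zero => exact (mismatch_le_left _ _).trans (S.length_u 0 i).le
  | succ n ih =>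
    obtain ⟨π, hπ, hi⟩ := S.exists_eq_permutedConcat n i
    obtain ⟨τ, hτ, hj⟩ := S.exists_eq_permutedConcat n j
    rw [hi, hj, permutedConcat, permutedConcat,
      mismatch_flatten_ofFn _ _ fun k => by simp [S.length_u], diffBound, numPermuted,
      Nat.card_eq_fintype_card, Fintype.card_subtype, Finset.card_filter, Finset.sum_mul]
    refine Finset.sum_le_sum fun k _ => ?_
    rw [mismatch_append rfl, mismatch_self, zero_add]
    split_ifs with hk
    · simpa using ih _ _
    · simp [hπ k hk, hτ k hk]

/-- One level multiplies the difference bound by `p_n ≤ c N_n` but the length by at least `N_n`. -/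
theorem diffBound_le {c : ℝ} (hc : 0 ≤ c) (h : ∀ n, (S.numPermuted n : ℝ) ≤ c * S.N n) (n : ℕ) :
    (S.diffBound n : ℝ) ≤ c ^ n * S.l n := by
  induction n with
  | zero => simp [diffBound]
  | succ n ih =>
    have h1 : (S.l n * S.N n : ℝ) ≤ S.l (n + 1) := by
      rw [S.l_succ]; push_cast; exact le_add_of_nonneg_right (by positivity)
    rw [diffBound]
    push_cast
    calc (S.numPermuted n : ℝ) * S.diffBound n ≤ (c * S.N n) * (c ^ n * S.l n) := by
          gcongr; exact h n
      _ = c ^ (n + 1) * (S.l n * S.N n) := by ring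
      _ ≤ _ := by gcongr

/-- Words of level `m + k` are spelled by words of level `m`, beginning without a spacer. -/
theorem exists_eq_spell (hP : ∀ N, 1 ∉ P N) (hN : ∀ n, 0 < S.N n) (m k : ℕ)
    (i : Fin (S.N (m + k))) : ∃ a L, S.u (m + k) i = spell s (S.u m) ((false, a) :: L) := by
  induction k with
  | zero => exact ⟨i, [], by simp [spell]⟩
  | succ k ih =>
    have main : ∀ L : List (Bool × Fin (S.N (m + k))),
        ∃ L', spell s (S.u (m + k)) L = spell s (S.u m) L' := by
      intro L
      induction L with
      | nil => exact ⟨[], by simp [spell]⟩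
      | cons q L ihL =>
        obtain ⟨b, q⟩ := q
        obtain ⟨a, L₁, h1⟩ := ih q
        obtain ⟨L₂, h2⟩ := ihL
        refine ⟨(b, a) :: L₁ ++ L₂, ?_⟩
        rw [spell_append, ← h2, spell_cons, spell_cons, h1, spell_cons]
        simp
    obtain ⟨π, -, hi⟩ := S.exists_eq_permutedConcat (m + k) i
    obtain ⟨i', L, h, -⟩ := exists_permutedConcat_eq_spell (P (S.N (m + k))) s (S.u (m + k)) π
      (hN _) (hP _)
    obtain ⟨a, L₁, h1⟩ := ih i'
    obtain ⟨L₂, h2⟩ := main L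
    refine ⟨a, L₁ ++ L₂, ?_⟩
    refine (hi.trans h).trans ?_
    rw [← List.cons_append, spell_append, ← h2, spell_cons, h1]
    simp

/-- Each group spells one level-`(n + 1)` word. The extra flag allowed by `+ 1` is a spacer of a
higher level, in front of the first word of the group, where level `n` puts none. -/
theorem exists_groups (hP : ∀ N, 1 ∉ P N) (hN : ∀ n, 0 < S.N n) (n : ℕ)
    (L : List (Bool × Fin (S.N (n + 1)))) :
    ∃ G : List (List (Bool × Fin (S.N n))),
      (∀ g ∈ G, g.length = S.N n ∧ (g.countP fun q => q.1) ≤ S.numPermuted n + 1) ∧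
      spell s (S.u (n + 1)) L = spell s (S.u n) G.flatten := by
  induction L with
  | nil => exact ⟨[], by simp, by simp [spell]⟩
  | cons q L ih =>
    obtain ⟨b, i⟩ := q
    obtain ⟨G, hG, hL⟩ := ih
    obtain ⟨π, -, hi⟩ := S.exists_eq_permutedConcat n i
    obtain ⟨a, M, h, hM, hc⟩ := exists_permutedConcat_eq_spell (P (S.N n)) s (S.u n) π
      (hN _) (hP _)
    refine ⟨((b, a) :: M) :: G, ?_, ?_⟩
    · intro g hg
      rcases List.mem_cons.1 hg with rfl | hg
      · refine ⟨by simpa using hM, ?_⟩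
        rw [List.countP_cons, numPermuted]
        split_ifs <;> omega
      · exact hG g hg
    · rw [List.flatten_cons, spell_append, ← hL, spell_cons, spell_cons, hi, h, spell_cons]
      simp

/-- A word of a level above `n` has few mismatches in each of its windows under the shift by
`l n`. -/
theorem shiftMismatch_mul_le [DecidableEq A] (hP : ∀ N, 1 ∉ P N) (hN : ∀ n, 0 < S.N n) {n K : ℕ}
    (hK : s = [] ∨ S.l n + s.length ≤ K) {j : ℕ} (hj : n < j) (i : Fin (S.N j)) (v : List A)
    (hv : v <:+: S.u j i) :
    shiftMismatch (S.l n) v * (S.N n * S.l n) ≤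
      2 * (S.l n + s.length) * (S.N n * S.l n) + S.diffBound n * S.N n * v.length +
        K * ((S.numPermuted n + 1) * (v.length + 2 * S.N n * S.l n)) := by
  obtain ⟨k, rfl⟩ : ∃ k, j = n + 1 + k := ⟨j - (n + 1), by omega⟩
  obtain ⟨a, L, h⟩ := S.exists_eq_spell hP hN (n + 1) k i
  obtain ⟨G, hG, hL⟩ := S.exists_groups hP hN n ((false, a) :: L)
  rw [h, hL] at hv
  obtain ⟨M, x, y, rfl, hM, hx, hy⟩ :=
    exists_infix_of_infix_spell (S.length_u n) le_rfl _ v hv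
  have hc := countP_mul_le_of_infix_flatten (fun q => q.1) G hG M hM
  have h1 := shiftMismatch_spell_le (S.length_u n) (S.mismatch_le_diffBound n) hK M
  have h2 := shiftMismatch_append_le_right (S.l n) (x ++ spell s (S.u n) M) y
  have h3 := shiftMismatch_append_le_left (S.l n) x (spell s (S.u n) M)
  have h4 := length_mul_le_length_spell (s := s) (S.length_u n) M
  have h5 : M.length * S.l n ≤ (x ++ spell s (S.u n) M ++ y).length := by
    simp only [List.length_append]; omega
  set w := x ++ spell s (S.u n) M ++ y
  set q := M.countP fun q => q.1
  have h6 : shiftMismatch (S.l n) w ≤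
      2 * (S.l n + s.length) + (S.diffBound n * M.length + K * q) := by omega
  calc _ ≤ (2 * (S.l n + s.length) + (S.diffBound n * M.length + K * q)) * (S.N n * S.l n) := by
        gcongr
    _ = 2 * (S.l n + s.length) * (S.N n * S.l n) + S.diffBound n * S.N n * (M.length * S.l n) +
        K * (q * S.N n) * S.l n := by ring
    _ ≤ 2 * (S.l n + s.length) * (S.N n * S.l n) + S.diffBound n * S.N n * w.length +
        K * ((S.numPermuted n + 1) * (M.length + 2 * S.N n)) * S.l n := by gcongr
    _ = 2 * (S.l n + s.length) * (S.N n * S.l n) + S.diffBound n * S.N n * w.length +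
        K * ((S.numPermuted n + 1) * (M.length * S.l n + 2 * S.N n * S.l n)) := by ring
    _ ≤ _ := by gcongr

/-- Once a level has at most one word, so do all later ones, and lengths stop growing. Word lengths
are then bounded, and long windows of a point fit nowhere. -/
theorem one_lt_N (hP : ∀ N, 1 ∉ P N) (hX : S.subshift.Nonempty) (n : ℕ) : 1 < S.N n := by
  by_contra! hn
  have hzero : ∀ m, S.N m ≤ 1 → S.numPermuted m = 0 := by
    intro m hm
    rw [numPermuted, Nat.card_eq_zero]
    left
    refine ⟨fun ⟨i, hi⟩ => hP (S.N m) ?_⟩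
    have : (i : ℕ) = 0 := by omega
    simpa [this] using hi
  have hone : ∀ k, S.N (n + k) ≤ 1 := by
    intro k
    induction k with
    | zero => exact hn
    | succ k ih =>
      by_contra! h
      have : (⟨0, zero_lt_one.trans h⟩ : Fin (S.N (n + (k + 1)))) = ⟨1, h⟩ := by
        apply S.u_injective
        obtain ⟨π, -, hi⟩ := S.exists_eq_permutedConcat (n + k) ⟨0, zero_lt_one.trans h⟩
        obtain ⟨τ, -, hj⟩ := S.exists_eq_permutedConcat (n + k) ⟨1, h⟩
        have : Subsingleton (Fin (S.N (n + k))) := Fin.subsingleton_iff_le_one.2 ih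
        obtain rfl := Subsingleton.elim π τ
        exact hi.trans hj.symm
      simp at this
  have hl : ∀ k, S.l (n + k) ≤ S.l n := by
    intro k
    induction k with
    | zero => rfl
    | succ k ih =>
      have h0 : Nat.card {i : Fin (S.N (n + k)) // (i : ℕ) + 1 ∈ P (S.N (n + k))} = 0 :=
        hzero _ (hone k)
      rw [← add_assoc, S.l_succ, h0]
      nlinarith [hone k]
  obtain ⟨x, hx⟩ := hX
  obtain ⟨j, i, h⟩ := hx 0 (∑ m ∈ Finset.range (n + 1), S.l m + 1)
  have h1 := h.length_le
  rw [S.length_u, List.length_ofFn] at h1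
  have h2 : ∀ m ≤ n, S.l m ≤ ∑ m ∈ Finset.range (n + 1), S.l m := fun m hm =>
    Finset.single_le_sum (f := S.l) (fun _ _ => Nat.zero_le _) (Finset.mem_range.2 (by omega))
  rcases le_total j n with hj | hj
  · have := h2 j hj; omega
  · obtain ⟨k, rfl⟩ := Nat.exists_eq_add_of_le hj
    have := h2 n le_rfl; have := hl k; omega

theorem l_pos (h : ∀ n, 1 < S.N n) (n : ℕ) : 0 < S.l n := by
  by_contra! hn
  have : (⟨0, by have := h n; omega⟩ : Fin (S.N n)) = ⟨1, h n⟩ := by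
    apply S.u_injective
    rw [List.eq_nil_of_length_eq_zero ((S.length_u n _).trans (by omega)),
      List.eq_nil_of_length_eq_zero ((S.length_u n _).trans (by omega))]
  simp at this

theorem exists_lt_level {x : ℤ → A} (hx : x ∈ S.subshift) (n : ℕ) (m : ℤ) (W : ℕ) :
    ∃ j, n < j ∧ ∃ i, (List.ofFn fun t : Fin W => x (m + ((t : ℕ) : ℤ))) <:+: S.u j i := by
  obtain ⟨j, i, h⟩ := hx m (W + (∑ m ∈ Finset.range (n + 1), S.l m + 1))
  -- The window is prolonged beyond the length of every word of level at most `n`.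
  refine ⟨j, ?_, i, List.IsInfix.trans ⟨[], List.ofFn fun t : Fin
    (∑ m ∈ Finset.range (n + 1), S.l m + 1) => x (m + ((W + t : ℕ) : ℤ)), ?_⟩ h⟩
  · by_contra! hj
    have h1 := h.length_le
    rw [S.length_u, List.length_ofFn] at h1
    have : S.l j ≤ ∑ m ∈ Finset.range (n + 1), S.l m :=
      Finset.single_le_sum (f := S.l) (fun _ _ => Nat.zero_le _) (Finset.mem_range.2 (by omega))
    omega
  · generalize ∑ m ∈ Finset.range (n + 1), S.l m + 1 = r
    rw [List.ofFn_add]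
    rfl

end BlockConstruction

theorem mismatch_ofFn {A : Type} [DecidableEq A] {N : ℕ} (f g : Fin N → A) :
    mismatch (List.ofFn f) (List.ofFn g) = ∑ i, if f i ≠ g i then 1 else 0 := by
  induction N with
  | zero => simp [mismatch]
  | succ N ih => rw [List.ofFn_succ, List.ofFn_succ, mismatch_cons, ih, Fin.sum_univ_succ]

theorem card_le_shiftMismatch {A : Type} [DecidableEq A] (x : ℤ → A) (L l : ℕ) :
    ∑ t ∈ Finset.range L, (if x t ≠ x (t + l) then 1 else 0) ≤
      shiftMismatch l (List.ofFn fun t : Fin (L + l) => x (0 + ((t : ℕ) : ℤ))) := by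
  have h : (List.ofFn fun t : Fin (L + l) => x (0 + ((t : ℕ) : ℤ))).drop l =
      List.ofFn fun t : Fin L => x ((t : ℕ) + l) := by
    apply List.ext_getElem
    · simp
    · intro i h1 h2
      simp [add_comm]
  rw [shiftMismatch, h, List.ofFn_add]
  rw [← List.append_nil (List.ofFn fun t : Fin L => x ((t : ℕ) + l)),
    mismatch_append (by simp), mismatch_ofFn, Finset.sum_range]
  simp

/-! ### Invariant measures: from coordinate mismatches to rigidity -/

section Shift

variable {A : Type}

theorem leftShift_iterate (k : ℕ) (x : ℤ → A) (n : ℤ) : leftShift^[k] x n = x (n + k) := by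
  induction k generalizing x with
  | zero => simp
  | succ k ih => rw [Function.iterate_succ_apply, ih, leftShift]; push_cast; congr 1; ring

theorem image_leftShift_iterate (k : ℕ) (E : Set (ℤ → A)) :
    leftShift^[k] '' E = (fun (x : ℤ → A) n => x (n - k)) ⁻¹' E := by
  refine congrFun (Set.image_eq_preimage_of_inverse ?_ ?_) E
  · intro x; funext n; simp [leftShift_iterate]
  · intro x; funext n; simp [leftShift_iterate]

variable [MeasurableSpace A]

theorem measure_image_symmDiff {μ : Measure (ℤ → A)} (hσ : MeasurePreserving leftShift μ μ)
    (k : ℕ) {E : Set (ℤ → A)} (hE : MeasurableSet E) :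
    μ ((leftShift^[k] '' E) ∆ E) = μ (E ∆ (leftShift^[k] ⁻¹' E)) := by
  have hm : MeasurableSet (leftShift^[k] '' E) := by
    rw [image_leftShift_iterate]
    exact (measurable_pi_lambda _ fun n => measurable_pi_apply _) hE
  rw [← (hσ.iterate k).measure_preimage (hm.symmDiff hE).nullMeasurableSet,
    Set.preimage_symmDiff, Set.preimage_image_eq]
  intro x y h
  funext n
  have := congrFun h (n - k)
  simpa [leftShift_iterate] using this

variable [Countable A] [DiscreteMeasurableSpace A]

theorem measurableSet_apply_ne (i j : ℤ) : MeasurableSet {x : ℤ → A | x i ≠ x j} := by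
  have h : Measurable fun x : ℤ → A => (x i, x j) :=
    (measurable_pi_apply i).prodMk (measurable_pi_apply j)
  exact h (MeasurableSet.of_discrete (s := {q : A × A | q.1 ≠ q.2}))

theorem measure_apply_ne_eq {μ : Measure (ℤ → A)} (hσ : MeasurePreserving leftShift μ μ)
    (l : ℕ) (i : ℤ) : μ {x | x i ≠ x (i + l)} = μ {x | x 0 ≠ x l} := by
  have key : ∀ i : ℤ, μ {x | x (i + 1) ≠ x (i + 1 + l)} = μ {x | x i ≠ x (i + l)} := by
    intro i
    rw [← hσ.measure_preimage (measurableSet_apply_ne i (i + l)).nullMeasurableSet]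
    simp only [Set.preimage_ofPred_eq, leftShift]
    rw [add_right_comm]
  induction i with
  | zero => simp
  | succ i ih => rw [key, ih]
  | pred i ih => rw [← ih, ← key]; simp

/-- The pointwise count is integrated over `μ`; by invariance its `L` summands have equal integrals.
The weight `w` keeps the bound in `ℕ`, free of division. -/
theorem mul_measure_apply_ne_le {μ : Measure (ℤ → A)} [DecidableEq A] {X : Set (ℤ → A)}
    (hμ : IsInvariantProbabilityOn X μ) (l L w C : ℕ)
    (h : ∀ x ∈ X, (∑ t ∈ Finset.range L, (if x t ≠ x (t + l) then 1 else 0)) * w ≤ C) :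
    (L * w : ENNReal) * μ {x | x 0 ≠ x l} ≤ C := by
  have := hμ.isProbabilityMeasure
  have hX : ∀ᵐ x ∂μ, x ∈ X := hμ.compl_eq_zero
  calc (L * w : ENNReal) * μ {x | x 0 ≠ x l}
      = (∑ t ∈ Finset.range L, μ {x | x (t : ℤ) ≠ x (t + l)}) * w := by
        simp_rw [measure_apply_ne_eq hμ.measurePreserving]
        simp; ring
    _ = ∫⁻ x, (∑ t ∈ Finset.range L,
          Set.indicator {x : ℤ → A | x (t : ℤ) ≠ x (t + l)} 1 x) * (w : ENNReal) ∂μ := by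
        rw [lintegral_mul_const', lintegral_finsetSum]
        · simp_rw [lintegral_indicator_one (measurableSet_apply_ne _ _)]
        · exact fun t _ => measurable_one.indicator (measurableSet_apply_ne _ _)
        · simp
    _ ≤ ∫⁻ _, (C : ENNReal) ∂μ := by
        refine lintegral_mono_ae ?_
        filter_upwards [hX] with x hx
        refine le_trans (le_of_eq ?_) (Nat.cast_le.2 (h x hx))
        push_cast
        congr 1
        refine Finset.sum_congr rfl fun t _ => ?_
        simp [Set.indicator_apply]
    _ = C := by simp

/-- A cylinder depends on finitely many coordinates, each changed by the shift with probability
tending to zero. Complements and disjoint unions preserve the convergence, so the π-λ argument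
applies. -/
theorem isMetricallyRigidAlong_of_tendsto {μ : Measure (ℤ → A)} [IsProbabilityMeasure μ]
    (hσ : MeasurePreserving leftShift μ μ) (l : ℕ → ℕ)
    (h : Tendsto (fun n => μ {x | x 0 ≠ x (l n)}) atTop (𝓝 0)) : IsMetricallyRigidAlong μ l := by
  intro E hE
  simp_rw [measure_image_symmDiff hσ _ hE]
  induction E, hE using MeasurableSpace.induction_on_inter
    (generateFrom_measurableCylinders (α := fun _ : ℤ => A)).symm
    isPiSystem_measurableCylinders with
  | empty => simp
  | basic E hE =>
    obtain ⟨s, S, -, rfl⟩ := (mem_measurableCylinders E).1 hE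
    have hle : ∀ n, μ (cylinder s S ∆ (leftShift^[l n] ⁻¹' cylinder s S)) ≤
        s.card * μ {x | x 0 ≠ x (l n)} := by
      intro n
      calc _ ≤ μ (⋃ i ∈ s, {x | x i ≠ x (i + l n)}) := by
            refine measure_mono fun x hx => ?_
            by_contra hx'
            simp only [Set.mem_iUnion, not_exists, Set.mem_ofPred_eq, not_not] at hx'
            have : s.restrict (leftShift^[l n] x) = s.restrict x := by
              funext i
              simp only [Finset.restrict, leftShift_iterate]
              exact (hx' i i.2).symm
            simp [Set.mem_symmDiff, mem_cylinder, this] at hx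
        _ ≤ ∑ i ∈ s, μ {x | x i ≠ x (i + l n)} := measure_biUnion_finset_le _ _
        _ = _ := by simp_rw [measure_apply_ne_eq hσ]; simp
    refine tendsto_of_tendsto_of_tendsto_of_le_of_le tendsto_const_nhds ?_ (fun n => zero_le) hle
    simpa using ENNReal.Tendsto.const_mul h (Or.inr (ENNReal.natCast_ne_top s.card))
  | compl E hE ih =>
    simpa only [Set.preimage_compl, compl_symmDiff_compl] using ih
  | iUnion f hd hf ih =>
    rw [ENNReal.tendsto_nhds_zero]
    intro ε hε
    -- The tail of the union has small measure, and so has its preimage by invariance; only finitely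
    -- many `f i` remain.
    have ht := tendsto_measure_biUnion_Ici_zero_of_pairwise_disjoint
      (μ := μ) (fun i => (hf i).nullMeasurableSet) hd
    have hε3 : 0 < ε / 3 := ENNReal.div_pos hε.ne' (by simp)
    obtain ⟨k, hk⟩ := ((ENNReal.tendsto_nhds_zero.1 ht) (ε / 3) hε3).exists
    have hs : Tendsto (fun n => ∑ i ∈ Finset.range k, μ (f i ∆ (leftShift^[l n] ⁻¹' f i)))
        atTop (𝓝 0) := by
      simpa using tendsto_finsetSum (Finset.range k) fun i _ => ih i
    filter_upwards [(ENNReal.tendsto_nhds_zero.1 hs) (ε / 3) hε3] with n hn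
    set T := ⋃ i ∈ Set.Ici k, f i
    have hT : MeasurableSet T := MeasurableSet.biUnion (Set.to_countable _) fun i _ => hf i
    have hsub : (⋃ i, f i) ∆ (leftShift^[l n] ⁻¹' ⋃ i, f i) ⊆
        (⋃ i ∈ Finset.range k, f i ∆ (leftShift^[l n] ⁻¹' f i)) ∪
          (T ∪ leftShift^[l n] ⁻¹' T) := by
      intro x hx
      simp only [Set.mem_symmDiff, Set.mem_preimage, Set.mem_iUnion, Set.mem_union, T,
        Finset.mem_range, Set.mem_Ici, exists_prop] at hx ⊢
      rcases hx with ⟨⟨i, hi⟩, hx⟩ | ⟨⟨i, hi⟩, hx⟩ <;> rcases lt_or_ge i k with hik | hik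
      · exact Or.inl ⟨i, hik, Or.inl ⟨hi, fun h => hx ⟨i, h⟩⟩⟩
      · exact Or.inr (Or.inl ⟨i, hik, hi⟩)
      · exact Or.inl ⟨i, hik, Or.inr ⟨hi, fun h => hx ⟨i, h⟩⟩⟩
      · exact Or.inr (Or.inr ⟨i, hik, hi⟩)
    calc _ ≤ _ := measure_mono hsub
      _ ≤ (∑ i ∈ Finset.range k, μ (f i ∆ (leftShift^[l n] ⁻¹' f i))) +
          (μ T + μ (leftShift^[l n] ⁻¹' T)) :=
        (measure_union_le _ _).trans
          (add_le_add (measure_biUnion_finset_le _ _) (measure_union_le _ _))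
      _ ≤ ε / 3 + (ε / 3 + ε / 3) := by
        rw [(hσ.iterate (l n)).measure_preimage hT.nullMeasurableSet]
        gcongr <;> exact hk
      _ = ε := by rw [← add_assoc, ENNReal.add_thirds]

end Shift

/-! ### The rigidity criterion for block constructions -/

namespace BlockConstruction

variable {A : Type} {P : ℕ → Set ℕ} {s : List A} (S : BlockConstruction A P s)

theorem measure_apply_ne_le [MeasurableSpace A] [Countable A] [DiscreteMeasurableSpace A]
    {μ : Measure (ℤ → A)} (hμ : IsInvariantProbabilityOn S.subshift μ)
    (hP : ∀ N, 1 ∉ P N) (hN : ∀ n, 1 < S.N n) {n K : ℕ} (hK : s = [] ∨ S.l n + s.length ≤ K) :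
    μ.real {x | x 0 ≠ x (S.l n)} ≤
      S.diffBound n / S.l n + K * (S.numPermuted n + 1) / (S.N n * S.l n) := by
  classical
  have := hμ.isProbabilityMeasure
  have hl : (0 : ℝ) < S.l n := by exact_mod_cast S.l_pos hN n
  have hN0 : (0 : ℝ) < S.N n := by exact_mod_cast zero_lt_one.trans (hN n)
  set r := μ.real {x | x 0 ≠ x (S.l n)} with hr
  set a : ℕ := 2 * (S.l n + s.length) * (S.N n * S.l n) +
    K * ((S.numPermuted n + 1) * (2 * S.N n * S.l n)) with ha
  set b : ℕ := S.diffBound n * S.N n + K * (S.numPermuted n + 1) with hb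
  have key : ∀ L : ℕ, (L * (S.N n * S.l n) : ℝ) * r ≤ a + b * (L + S.l n) := by
    intro L
    have h1 := mul_measure_apply_ne_le hμ (S.l n) L (S.N n * S.l n) (a + b * (L + S.l n)) (by
      intro x hx
      obtain ⟨j, hj, i, hi⟩ := S.exists_lt_level hx n 0 (L + S.l n)
      have h2 := S.shiftMismatch_mul_le hP (fun n => zero_lt_one.trans (hN n)) hK hj i _ hi
      rw [List.length_ofFn] at h2
      refine (Nat.mul_le_mul_right _ (card_le_shiftMismatch x L (S.l n))).trans (h2.trans ?_)
      rw [ha, hb]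
      apply le_of_eq
      ring)
    have h2 := ENNReal.toReal_mono (ENNReal.natCast_ne_top _) h1
    rw [ENNReal.toReal_mul, ENNReal.toReal_natCast] at h2
    simpa [Measure.real, hr] using h2
  -- Both sides of `key` are affine in `L`; letting `L` grow compares slopes and removes the end
  -- terms.
  have hmain : r * (S.N n * S.l n) ≤ b := by
    by_contra! hlt
    obtain ⟨L, hL⟩ := exists_nat_gt ((a + b * S.l n) / (r * (S.N n * S.l n) - b))
    rw [div_lt_iff₀ (by linarith)] at hL
    nlinarith [key L]
  calc r ≤ b / (S.N n * S.l n) := (le_div_iff₀ (by positivity)).2 hmain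
    _ = _ := by
      rw [hb]; push_cast; field_simp

theorem isMetricallyRigidAlong [MeasurableSpace A] [Countable A] [DiscreteMeasurableSpace A]
    {μ : Measure (ℤ → A)} (hμ : IsInvariantProbabilityOn S.subshift μ)
    (hP : ∀ N, 1 ∉ P N) (hN : ∀ n, 1 < S.N n) {c : ℝ} (hc0 : 0 ≤ c) (hc : c < 1)
    (hPc : ∀ n, (S.numPermuted n : ℝ) ≤ c * S.N n)
    (hs : s = [] ∨ Tendsto (fun n => (S.numPermuted n + 1 : ℝ) / S.N n) atTop (𝓝 0)) :
    IsMetricallyRigidAlong μ S.l := by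
  have := hμ.isProbabilityMeasure
  have hl : ∀ n, (0 : ℝ) < S.l n := fun n => by exact_mod_cast S.l_pos hN n
  have hN0 : ∀ n, (0 : ℝ) < S.N n := fun n => by exact_mod_cast zero_lt_one.trans (hN n)
  have hD : ∀ n, (S.diffBound n : ℝ) / S.l n ≤ c ^ n := fun n =>
    (div_le_iff₀ (hl n)).2 (S.diffBound_le hc0 hPc n)
  have hcn := tendsto_pow_atTop_nhds_zero_of_lt_one hc0 hc
  refine isMetricallyRigidAlong_of_tendsto hμ.measurePreserving _ ?_
  rw [← ENNReal.tendsto_toReal_iff (fun _ => measure_ne_top _ _) (by simp), ENNReal.toReal_zero]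
  rcases hs with hs | hs
  · refine squeeze_zero (fun _ => measureReal_nonneg) (fun n => ?_) hcn
    refine (S.measure_apply_ne_le hμ hP hN (K := 0) (Or.inl hs)).trans ?_
    simpa using hD n
  · have h0 := hcn.add (hs.const_mul (1 + s.length : ℝ))
    rw [mul_zero, add_zero] at h0
    refine squeeze_zero (fun _ => measureReal_nonneg) (fun n => ?_) h0
    -- This `K` is a multiple of `S.l n`, so the length cancels.
    refine (S.measure_apply_ne_le hμ hP hN (K := S.l n * (1 + s.length)) (Or.inr ?_)).trans ?_
    · nlinarith [S.l_pos hN n]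
    · refine add_le_add (hD n) (le_of_eq ?_)
      have := (hl n).ne'
      have := (hN0 n).ne'
      push_cast
      field_simp

end BlockConstruction

/-! ### Counting permuted positions and growth of the number of words -/

theorem card_succ_mem_eq_ncard (N : ℕ) (Q : Set ℕ) :
    Nat.card {i : Fin N // (i : ℕ) + 1 ∈ Q} = (Q ∩ Set.Icc 1 N).ncard := by
  rw [← Nat.card_coe_set_eq]
  refine Nat.card_congr ⟨fun i => ⟨i.1 + 1, i.2, by simp, i.1.2⟩,
    fun p => ⟨⟨p.1 - 1, by have := p.2.2.1; have := p.2.2.2; omega⟩, ?_⟩, ?_, ?_⟩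
  · have := p.2.2.1
    simpa [Nat.sub_add_cancel this] using p.2.1
  · intro i; ext; simp
  · intro p; ext; exact Nat.sub_add_cancel p.2.2.1

theorem spacerPositions_eq (N : ℕ) :
    spacerPositions N = (fun i => i ^ 2) '' Set.Icc 2 (Nat.sqrt N) := by
  ext p
  simp only [spacerPositions, Set.mem_ofPred_eq, Set.mem_image, Set.mem_Icc]
  constructor
  · rintro ⟨i, h1, h2, rfl⟩; exact ⟨i, ⟨h1, h2⟩, rfl⟩
  · rintro ⟨i, ⟨h1, h2⟩, rfl⟩; exact ⟨i, h1, h2, rfl⟩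

theorem ncard_Icc (a b : ℕ) : (Set.Icc a b).ncard = b + 1 - a := by
  rw [← Finset.coe_Icc, Set.ncard_coe_finset, Nat.card_Icc]

theorem ncard_spacerPositions (N : ℕ) : (spacerPositions N).ncard = Nat.sqrt N - 1 := by
  rw [spacerPositions_eq, Set.ncard_image_of_injective _ (Nat.pow_left_injective (by norm_num)),
    ncard_Icc]
  omega

theorem card_spacerPositions (N : ℕ) :
    Nat.card {i : Fin N // (i : ℕ) + 1 ∈ spacerPositions N} = Nat.sqrt N - 1 := by
  rw [card_succ_mem_eq_ncard, ← ncard_spacerPositions, Set.inter_eq_left.2]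
  rintro p ⟨i, h1, h2, rfl⟩
  refine ⟨Nat.one_le_pow _ _ (by omega), ?_⟩
  rw [Nat.le_sqrt'] at h2
  exact h2

theorem squarePositions_eq (N : ℕ) : squarePositions N = insert 2 (spacerPositions N) := rfl

theorem card_squarePositions_le (N : ℕ) :
    Nat.card {i : Fin N // (i : ℕ) + 1 ∈ squarePositions N} ≤ Nat.sqrt N - 1 + 1 := by
  rw [card_succ_mem_eq_ncard, squarePositions_eq, ← ncard_spacerPositions]
  refine (Set.ncard_le_ncard Set.inter_subset_left ?_).trans (Set.ncard_insert_le _ _)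
  rw [spacerPositions_eq]
  exact ((Set.finite_Icc _ _).image _).insert _

theorem card_powerPositions_le {α : ℝ} (N : ℕ) :
    Nat.card {i : Fin N // (i : ℕ) + 1 ∈ powerPositions α N} ≤ ⌊(N : ℝ) ^ α⌋₊ := by
  have hsub : powerPositions α N ⊆ (fun i => i ^ ⌊1 / α⌋₊) '' Set.Icc 1 ⌊(N : ℝ) ^ α⌋₊ := by
    rintro p ⟨i, h1, h2, rfl⟩
    exact ⟨i, ⟨h1.le, Nat.le_floor h2⟩, rfl⟩
  rw [card_succ_mem_eq_ncard]
  calc _ ≤ ((fun i => i ^ ⌊1 / α⌋₊) '' Set.Icc 1 ⌊(N : ℝ) ^ α⌋₊).ncard :=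
        Set.ncard_le_ncard (Set.inter_subset_left.trans hsub) ((Set.finite_Icc _ _).image _)
    _ ≤ _ := (Set.ncard_image_le (Set.finite_Icc _ _)).trans (by rw [ncard_Icc]; omega)

theorem one_notMem_spacerPositions (N : ℕ) : 1 ∉ spacerPositions N := by
  rintro ⟨i, h1, -, h⟩
  nlinarith

theorem one_notMem_squarePositions (N : ℕ) : 1 ∉ squarePositions N := by
  rw [squarePositions_eq]
  simpa using one_notMem_spacerPositions N

theorem one_notMem_powerPositions {α : ℝ} (h0 : 0 < α) (h1 : α < 1) (N : ℕ) :
    1 ∉ powerPositions α N := by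
  rintro ⟨i, hi, -, h⟩
  have : 1 ≤ ⌊1 / α⌋₊ := Nat.le_floor (by rw [Nat.cast_one, le_div_iff₀ h0]; linarith)
  exact (Nat.one_lt_pow (by omega) hi).ne h

theorem two_mul_sqrt_le {N : ℕ} (hN : 1 < N) : 2 * Nat.sqrt N ≤ N := by
  have := Nat.sqrt_le N
  rcases lt_or_ge (Nat.sqrt N) 2 with h | h
  · omega
  · nlinarith

theorem permutedConcat_injective {A : Type} {N l : ℕ} (P : Set ℕ) (s : List A)
    {u : Fin N → List A} (hl : ∀ i, (u i).length = l) (hu : Function.Injective u) :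
    Function.Injective (permutedConcat P s u) := by
  classical
  have key : ∀ {M : ℕ} (f g : Fin M → List A), (∀ i, (f i).length = (g i).length) →
      (List.ofFn f).flatten = (List.ofFn g).flatten → f = g := by
    intro M
    induction M with
    | zero => intros; exact Subsingleton.elim _ _
    | succ M ih =>
      intro f g h hfg
      rw [List.ofFn_succ, List.ofFn_succ, List.flatten_cons, List.flatten_cons] at hfg
      obtain ⟨h1, h2⟩ := List.append_inj hfg (h 0)
      have h3 := ih _ _ (fun i => h i.succ) h2
      funext i
      refine Fin.cases h1 (fun i => congrFun h3 i) i
  intro π τ h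
  ext1 i
  have := congrFun (key _ _ (fun i => by simp [hl]) h) i
  exact hu (List.append_cancel_left this)

namespace BlockConstruction

variable {A : Type} {P : ℕ → Set ℕ} {s : List A} (S : BlockConstruction A P s)

/-- Distinct permutations give distinct words, and those fixing the other positions are the
permutations of the permuted ones. -/
theorem N_succ (n : ℕ) : S.N (n + 1) = (S.numPermuted n).factorial := by
  classical
  have h1 : (Set.range (S.u (n + 1))).ncard = S.N (n + 1) := by
    rw [← Set.image_univ, Set.ncard_image_of_injective _ (S.u_injective _), Set.ncard_univ]
    simp
  have h2 : {w | ∃ π : Equiv.Perm (Fin (S.N n)),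
      (∀ i : Fin (S.N n), (i : ℕ) + 1 ∉ P (S.N n) → π i = i) ∧
        w = permutedConcat (P (S.N n)) s (S.u n) π} =
      permutedConcat (P (S.N n)) s (S.u n) ''
        {π | ∀ i : Fin (S.N n), (i : ℕ) + 1 ∉ P (S.N n) → π i = i} := by
    ext w; simp [eq_comm]
  rw [← h1, S.range_succ, h2,
    Set.ncard_image_of_injective _ (permutedConcat_injective _ _ (S.length_u n) (S.u_injective n)),
    numPermuted, ← Nat.card_coe_set_eq]
  exact (Nat.card_congr (Equiv.Perm.subtypeEquivSubtypePerm
    fun i : Fin (S.N n) => (i : ℕ) + 1 ∈ P (S.N n))).symm.trans Nat.card_perm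

end BlockConstruction

theorem succ_sq_le_factorial {k : ℕ} (hk : 5 ≤ k) : (k + 2) ^ 2 ≤ k.factorial := by
  induction k, hk using Nat.le_induction with
  | base => decide
  | succ k hk ih =>
    rw [Nat.factorial_succ]
    nlinarith

theorem lt_factorial_sqrt_sub_one {N : ℕ} (hN : 36 ≤ N) : N < (Nat.sqrt N - 1).factorial := by
  have h6 : 6 ≤ Nat.sqrt N := Nat.le_sqrt.2 (by omega)
  have h2 := Nat.lt_succ_sqrt N
  have h3 := succ_sq_le_factorial (k := Nat.sqrt N - 1) (by omega)
  obtain ⟨k, hk⟩ : ∃ k, Nat.sqrt N = k + 1 := ⟨Nat.sqrt N - 1, by omega⟩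
  rw [hk] at h2 h3 ⊢
  simp only [Nat.add_sub_cancel, Nat.succ_eq_add_one] at *
  nlinarith

theorem tendsto_atTop_of_eq_factorial_sqrt {N : ℕ → ℕ} (hN : ∀ n, 1 < N n)
    (h : ∀ n, N (n + 1) = (Nat.sqrt (N n) - 1).factorial) : Tendsto N atTop atTop := by
  have step : ∀ n a, N n < a * a → N (n + 1) ≤ (a - 1 - 1).factorial := by
    intro n a ha
    rw [h]
    have := Nat.sqrt_lt.2 ha
    exact Nat.factorial_le (by omega)
  have h36 : ∀ n, 36 ≤ N n := by
    intro n
    -- Below `36` the recursion collapses: the next values are at most `4! = 24`, `3! = 6` and `1! =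
    -- 1`, contradicting `1 < N`.
    by_contra! hn
    have h1 := step n 6 (by omega)
    have h2 := step (n + 1) 5 (h1.trans_lt (by decide))
    have h3 := step (n + 2) 3 (h2.trans_lt (by decide))
    have := hN (n + 3)
    exact absurd (h3.trans_lt' this) (by decide)
  have hmono : StrictMono N := strictMono_nat_of_lt_succ fun n => by
    rw [h]; exact lt_factorial_sqrt_sub_one (h36 n)
  exact hmono.tendsto_atTop

theorem IsInvariantProbabilityOn.nonempty {A : Type} [MeasurableSpace A] {X : Set (ℤ → A)}
    {μ : Measure (ℤ → A)} (hμ : IsInvariantProbabilityOn X μ) : X.Nonempty := by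
  by_contra! hX
  have := hμ.isProbabilityMeasure
  have h := hμ.compl_eq_zero
  rw [hX, Set.compl_empty, measure_univ] at h
  exact one_ne_zero h

/-! ### The three constructions -/

theorem isMetricallyRigidAlong_squarePositions
    (S : BlockConstruction (Fin 2) squarePositions []) (μ : Measure (ℤ → Fin 2))
    (hμ : IsInvariantProbabilityOn S.subshift μ) : IsMetricallyRigidAlong μ S.l := by
  have hN := S.one_lt_N one_notMem_squarePositions hμ.nonempty
  refine S.isMetricallyRigidAlong hμ one_notMem_squarePositions hN (c := 1 / 2) (by norm_num)
    (by norm_num) (fun n => ?_) (Or.inl rfl)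
  have h1 : S.numPermuted n ≤ _ := card_squarePositions_le (S.N n)
  have h2 := two_mul_sqrt_le (hN n)
  have h3 := Nat.sqrt_pos.2 (zero_lt_one.trans (hN n))
  have h4 : 2 * S.numPermuted n ≤ S.N n := by omega
  have : (2 * S.numPermuted n : ℝ) ≤ S.N n := by exact_mod_cast h4
  linarith

theorem isMetricallyRigidAlong_powerPositions {α : ℝ} (hα0 : 0 < α) (hα1 : α < 1)
    (S : BlockConstruction (Fin 2) (powerPositions α) []) (μ : Measure (ℤ → Fin 2))
    (hμ : IsInvariantProbabilityOn S.subshift μ) : IsMetricallyRigidAlong μ S.l := by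
  have hP := one_notMem_powerPositions hα0 hα1
  have hN := S.one_lt_N hP hμ.nonempty
  -- `N ^ α = N ^ (α - 1) * N`, and the first factor is largest at `N = 2`.
  refine S.isMetricallyRigidAlong hμ hP hN (c := (2 : ℝ) ^ (α - 1)) (by positivity)
    (Real.rpow_lt_one_of_one_lt_of_neg (by norm_num) (by linarith)) (fun n => ?_) (Or.inl rfl)
  have h2 : (2 : ℝ) ≤ S.N n := by exact_mod_cast hN n
  have hpos : (0 : ℝ) < S.N n := by linarith
  calc (S.numPermuted n : ℝ) ≤ ⌊(S.N n : ℝ) ^ α⌋₊ := by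
        exact_mod_cast card_powerPositions_le (α := α) (S.N n)
    _ ≤ (S.N n : ℝ) ^ α := Nat.floor_le (by positivity)
    _ = (S.N n : ℝ) ^ (α - 1) * S.N n := by
        rw [Real.rpow_sub_one hpos.ne', div_mul_cancel₀ _ hpos.ne']
    _ ≤ _ := by
        gcongr ?_ * _
        exact Real.rpow_le_rpow_of_nonpos (by norm_num) h2 (by linarith)

theorem isMetricallyRigidAlong_spacerPositions
    (S : BlockConstruction (Fin 3) spacerPositions [2]) (μ : Measure (ℤ → Fin 3))
    (hμ : IsInvariantProbabilityOn S.subshift μ) : IsMetricallyRigidAlong μ S.l := by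
  have hN := S.one_lt_N one_notMem_spacerPositions hμ.nonempty
  have hp : ∀ n, S.numPermuted n = Nat.sqrt (S.N n) - 1 := fun n => card_spacerPositions (S.N n)
  have hsq : ∀ n, 0 < Nat.sqrt (S.N n) := fun n => Nat.sqrt_pos.2 (zero_lt_one.trans (hN n))
  refine S.isMetricallyRigidAlong hμ one_notMem_spacerPositions hN (c := 1 / 2) (by norm_num)
    (by norm_num) (fun n => ?_) (Or.inr ?_)
  · have h2 := two_mul_sqrt_le (hN n)
    have h4 : 2 * S.numPermuted n ≤ S.N n := by have := hp n; omega
    have : (2 * S.numPermuted n : ℝ) ≤ S.N n := by exact_mod_cast h4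
    linarith
  · have ht : Tendsto S.N atTop atTop :=
      tendsto_atTop_of_eq_factorial_sqrt hN fun n => by rw [S.N_succ, hp]
    have ht2 : Tendsto (fun n => (Real.sqrt (S.N n))⁻¹) atTop (𝓝 0) :=
      (Real.tendsto_sqrt_atTop.comp (tendsto_natCast_atTop_atTop.comp ht)).inv_tendsto_atTop
    refine squeeze_zero (fun n => by positivity) (fun n => ?_) ht2
    have h1 : (S.numPermuted n + 1 : ℝ) = Nat.sqrt (S.N n) := by
      have := hsq n
      have h : S.numPermuted n + 1 = Nat.sqrt (S.N n) := by have := hp n; omega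
      exact_mod_cast h
    have h2 : (0 : ℝ) < S.N n := by exact_mod_cast zero_lt_one.trans (hN n)
    rw [h1, ← Real.sqrt_div_self]
    gcongr
    exact Real.nat_sqrt_le_real_sqrt

theorem mainTheorem5 :
    (∀ (S : BlockConstruction (Fin 2) squarePositions []) (μ : Measure (ℤ → Fin 2)),
      IsInvariantProbabilityOn S.subshift μ → IsMetricallyRigidAlong μ S.l) ∧
    (∀ α : ℝ, 0 < α → α < 1 →
      ∀ (S : BlockConstruction (Fin 2) (powerPositions α) []) (μ : Measure (ℤ → Fin 2)),
        IsInvariantProbabilityOn S.subshift μ → IsMetricallyRigidAlong μ S.l) ∧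
    (∀ (S : BlockConstruction (Fin 3) spacerPositions [2]) (μ : Measure (ℤ → Fin 3)),
      (∀ i, (2 : Fin 3) ∉ S.u 0 i) →
        IsInvariantProbabilityOn S.subshift μ → IsMetricallyRigidAlong μ S.l) :=
  ⟨isMetricallyRigidAlong_squarePositions,
    fun _ h0 h1 S μ hμ => isMetricallyRigidAlong_powerPositions h0 h1 S μ hμ,
    fun S μ _ hμ => isMetricallyRigidAlong_spacerPositions S μ hμ⟩
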